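/- Let $n\in\mathbb{N}$, $\mathcal{C}=[-1,1]^n$, let $\mathcal{H}^1$ be the one-dimensional Hausdorff measure on $\mathbb{R}^n$, and let $S\subset\mathcal{C}$ be Borel measurable and countably $1$-rectifiable, i.e. $S=\bigcup_{i=1}^\infty f_i(A_i)$ with $A_i\subset\mathbb{R}$ bounded and $f_i:A_i\to\mathbb{R}^n$ Lipschitz. Let $a\in[0,\infty]$ and let $b:S\to[0,a]$ be lower semi-continuous. For $x,y\in\mathbb{R}^n$ define the generalized urban metric $$d_{S,a,b}(x,y)=\inf_{\gamma}\left(\int_{\gamma([0,1])\cap S}b\,\mathrm{d}\mathcal{H}^1+a\,\mathcal{H}^1(\gamma([0,1])\setminus S)\right)\in[0,\infty]$$ (with $\infty\cdot 0=0$), where the infimum is over all Lipschitz paths $\gamma:[0,1]\to\mathbb{R}^n$ with $\gamma(0)=x$ and $\gamma(1)=y$. Let $\mu_+,\mu_-$ be Borel probability measures on $\mathbb{R}^n$ supported in $\mathcal{C}$, let $\Pi(\mu_+,\mu_-)$ be the set of transport plans, i.e. of Borel probability measures on $\mathbb{R}^n\times\mathbb{R}^n$ with first marginal $\mu_+$ and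 second marginal $\mu_-$, and let $$W_{d_{S,a,b}}(\mu_+,\mu_-)=\inf_{\pi\in\Pi(\mu_+,\mu_-)}\int_{\mathbb{R}^n\times\mathbb{R}^n}d_{S,a,b}\,\mathrm{d}\pi\in[0,\infty].$$ **Proposition (Existence of optimal transport plan).** Assume that $a<\infty$, or that $\mathcal{H}^1(\{z\in S : b(z)\le\lambda\})<\infty$ for all $\lambda\in[0,a)$. Then there exists a transport plan $\pi\in\Pi(\mu_+,\mu_-)$ such that $$W_{d_{S,a,b}}(\mu_+,\mu_-)=\int_{\mathbb{R}^n\times\mathbb{R}^n}d_{S,a,b}(x,y)\,\mathrm{d}\pi(x,y).$$ -/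

import Mathlib

open MeasureTheory Set
open scoped ENNReal

noncomputable section

namespace UrbanPlanning

/-- `ℝⁿ` with the Euclidean norm. -/
abbrev E (n : ℕ) : Type := EuclideanSpace ℝ (Fin n)

/-- The hypercube `[-1, 1]ⁿ`. -/
def hypercube (n : ℕ) : Set (E n) := {x | ∀ i, x i ∈ Icc (-1 : ℝ) 1}

/-- One-dimensional Hausdorff measure on `ℝⁿ`. -/
abbrev H1 (n : ℕ) : Measure (E n) := Measure.hausdorffMeasure 1

/-- `S` is a countable union of images `fᵢ(Aᵢ)` with `Aᵢ ⊆ ℝ` bounded and `fᵢ` Lipschitz on `Aᵢ`. -/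
def CountablyOneRectifiable {n : ℕ} (S : Set (E n)) : Prop :=
  ∃ (A : ℕ → Set ℝ) (f : ℕ → ℝ → E n),
    (∀ i, Bornology.IsBounded (A i) ∧ ∃ K, LipschitzOnWith K (f i) (A i)) ∧
      S = ⋃ i, f i '' A i

/-- The set `Γ^{xy}` of Lipschitz paths `γ : [0, 1] → ℝⁿ` with `γ 0 = x` and `γ 1 = y`. -/
def lipschitzPaths {n : ℕ} (x y : E n) : Set (unitInterval → E n) :=
  {γ | (∃ K, LipschitzWith K γ) ∧ γ 0 = x ∧ γ 1 = y}

/-- The cost `∫_{γ([0,1]) ∩ S} b dℋ¹ + a ℋ¹(γ([0,1]) \ S)` of a path;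
only the values of `b` on `S` enter. -/
def pathCost {n : ℕ} (S : Set (E n)) (a : ℝ≥0∞) (b : E n → ℝ≥0∞) (γ : unitInterval → E n) :
    ℝ≥0∞ :=
  (∫⁻ z in range γ ∩ S, b z ∂(H1 n)) + a * H1 n (range γ \ S)

/-- The generalized urban metric `d_{S,a,b}`. -/
def urbanMetric {n : ℕ} (S : Set (E n)) (a : ℝ≥0∞) (b : E n → ℝ≥0∞) (x y : E n) : ℝ≥0∞ :=
  ⨅ γ ∈ lipschitzPaths x y, pathCost S a b γ

/-- The set `Π(μ, ν)` of transport plans. -/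
def transportPlans {n : ℕ} (μ ν : Measure (E n)) : Set (Measure (E n × E n)) :=
  {π | IsProbabilityMeasure π ∧ π.fst = μ ∧ π.snd = ν}

/-- The total travel cost `∫ d_{S,a,b} dπ`. -/
def transportCost {n : ℕ} (S : Set (E n)) (a : ℝ≥0∞) (b : E n → ℝ≥0∞)
    (π : Measure (E n × E n)) : ℝ≥0∞ :=
  ∫⁻ p, urbanMetric S a b p.1 p.2 ∂π

/-- The Wasserstein distance `W_{d_{S,a,b}}(μ, ν)`. -/
def wassersteinDist {n : ℕ} (S : Set (E n)) (a : ℝ≥0∞) (b : E n → ℝ≥0∞)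
    (μ ν : Measure (E n)) : ℝ≥0∞ :=
  ⨅ π ∈ transportPlans μ ν, transportCost S a b π

/-- The part `S_λ = {z ∈ S | b z ≤ λ}` of the network. -/
def subNetwork {n : ℕ} (S : Set (E n)) (b : E n → ℝ≥0∞) (l : ℝ≥0∞) : Set (E n) :=
  {z ∈ S | b z ≤ l}

end UrbanPlanning

end

/-! This is the direct method. Plans with marginals on the compact cube form a nonempty, weakly
compact set, and `π ↦ ∫ d dπ` is lower semicontinuous as soon as `d` is, by the layer cake formula
and the portmanteau theorem. Everything rests on `lowerSemicontinuous_urbanMetric`.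

If `a < ∞`, this follows from the triangle inequality and `d x y ≤ a * edist x y`.

If `a = ∞`, take almost optimal paths between converging endpoints and replace each by a subcurve of
least Lipschitz constant. Minimality excludes loops, and comparison with the arc length
parametrization makes the constant equal to the length. Length is at most `H1 (S_1)` plus cost, so
the constants are bounded and Arzelà–Ascoli gives a limit path. At constant speed, length in an open
set is the speed times the time spent there, so Fatou's lemma makes it lower semicontinuous. Inner
regularity extends this to complements of sets of finite length, such as the superlevel sets of the
cost density, and the layer cake formula passes to the cost. -/

open Filter Topology
open scoped NNReal

namespace UrbanPlanning

/-! ### Lipschitz curves: minimal subcurves and arc length -/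

section Curves

/-- `σ` has the same endpoints as `γ` and its image lies in that of `γ`. -/
def IsSubcurve {X : Type*} (γ σ : unitInterval → X) : Prop :=
  σ 0 = γ 0 ∧ σ 1 = γ 1 ∧ range σ ⊆ range γ

lemma IsSubcurve.trans {X : Type*} {γ σ τ : unitInterval → X} (h : IsSubcurve γ σ) (h' : IsSubcurve σ τ) :
    IsSubcurve γ τ :=
  ⟨h'.1.trans h.1, h'.2.1.trans h.2.1, h'.2.2.trans h.2.2⟩

variable {X : Type*} [MetricSpace X]

/-- Pointwise limits of Lipschitz maps with converging constants are Lipschitz. -/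
lemma lipschitzWith_of_tendsto {Y : Type*} [PseudoMetricSpace Y] {M : ℕ → ℝ≥0} {m : ℝ≥0}
    {f : ℕ → Y → X} {g : Y → X} (hf : ∀ k, LipschitzWith (M k) (f k))
    (hM : Tendsto M atTop (𝓝 m)) (hg : ∀ t, Tendsto (fun k => f k t) atTop (𝓝 (g t))) :
    LipschitzWith m g := by
  refine LipschitzWith.of_dist_le_mul fun s t => ?_
  refine le_of_tendsto_of_tendsto ((hg s).dist (hg t))
    (((NNReal.continuous_coe.tendsto m).comp hM).mul_const (dist s t)) (Eventually.of_forall ?_)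
  intro k
  exact (hf k).dist_le_mul s t

/-- Curves that are uniformly Lipschitz and stay in a compact set subconverge pointwise. -/
lemma exists_subseq_tendsto_of_lipschitzWith {M : ℝ≥0} {K : Set X} (hK : IsCompact K)
    {f : ℕ → unitInterval → X} (hf : ∀ k, LipschitzWith M (f k)) (hfK : ∀ k t, f k t ∈ K) :
    ∃ (g : unitInterval → X) (φ : ℕ → ℕ), StrictMono φ ∧
      ∀ t, Tendsto (fun k => f (φ k) t) atTop (𝓝 (g t)) := by
  let A : Set (BoundedContinuousFunction unitInterval X) :=
    {h | LipschitzWith M h ∧ ∀ t, h t ∈ K}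
  have hA : IsCompact (closure A) := by
    refine BoundedContinuousFunction.arzela_ascoli K hK A (fun h t hh => hh.2 t) ?_
    exact (LipschitzWith.uniformEquicontinuous (fun h : A => (h.1 : unitInterval → X)) M
      (fun h => h.2.1)).equicontinuous
  let F : ℕ → BoundedContinuousFunction unitInterval X := fun k =>
    BoundedContinuousFunction.mkOfCompact ⟨f k, (hf k).continuous⟩
  obtain ⟨g, -, φ, hφ, hg⟩ := hA.tendsto_subseq (x := F)
    (fun k => subset_closure ⟨hf k, hfK k⟩)
  refine ⟨g, φ, hφ, fun t => ?_⟩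
  exact (BoundedContinuousFunction.tendsto_iff_tendstoUniformly.1 hg).tendsto_at t

/-- `σ` is an `m`-Lipschitz subcurve of `γ` and `m` is the least constant of any such curve. -/
def IsMinimalSubcurve (γ σ : unitInterval → X) (m : ℝ≥0) : Prop :=
  IsSubcurve γ σ ∧ LipschitzWith m σ ∧
    ∀ (m' : ℝ≥0) (τ : unitInterval → X), IsSubcurve γ τ → LipschitzWith m' τ → m ≤ m'

/-- A minimizing sequence of constants has a limit curve by Arzelà–Ascoli in the compact set `range
γ`; being a subcurve is preserved by pointwise limits. -/
lemma exists_isMinimalSubcurve {γ : unitInterval → X} {K : ℝ≥0} (hγ : LipschitzWith K γ) :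
    ∃ (σ : unitInterval → X) (m : ℝ≥0), IsMinimalSubcurve γ σ m := by
  let I : Set ℝ≥0 := {m | ∃ τ, IsSubcurve γ τ ∧ LipschitzWith m τ}
  have hI : I.Nonempty := ⟨K, γ, ⟨rfl, rfl, Subset.rfl⟩, hγ⟩
  obtain ⟨u, hu, hul, huI⟩ := exists_seq_tendsto_sInf hI (OrderBot.bddBelow I)
  choose τ hτ hτL using huI
  have hc : IsCompact (range γ) := isCompact_range hγ.continuous
  obtain ⟨σ, φ, hφ, hσ⟩ := exists_subseq_tendsto_of_lipschitzWith hc (M := u 0)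
    (fun k => (hτL k).weaken (hu (Nat.zero_le k))) (fun k t => (hτ k).2.2 (mem_range_self t))
  refine ⟨σ, sInf I, ⟨?_, ?_, ?_⟩, ?_, ?_⟩
  · exact tendsto_nhds_unique (hσ 0) (by simp only [(hτ _).1]; exact tendsto_const_nhds)
  · exact tendsto_nhds_unique (hσ 1) (by simp only [(hτ _).2.1]; exact tendsto_const_nhds)
  · rintro _ ⟨t, rfl⟩
    exact hc.isClosed.mem_of_tendsto (hσ t)
      (Eventually.of_forall fun k => (hτ _).2.2 (mem_range_self t))
  · exact lipschitzWith_of_tendsto (fun k => hτL (φ k)) (hul.comp hφ.tendsto_atTop) hσ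
  · intro m' τ' h1 h2
    exact csInf_le (OrderBot.bddBelow I) ⟨τ', h1, h2⟩

/-- Gluing two Lipschitz curves that meet at the parameter `c`. -/
lemma lipschitzWith_ite_le {F G : ℝ → X} {K : ℝ≥0} (hF : LipschitzWith K F)
    (hG : LipschitzWith K G) {c : ℝ} (hc : F c = G c) :
    LipschitzWith K (fun u => if u ≤ c then F u else G u) := by
  have key : ∀ u v : ℝ, u ≤ v →
      dist (if u ≤ c then F u else G u) (if v ≤ c then F v else G v) ≤ K * dist u v := by
    intro u v huv
    by_cases hv : v ≤ c
    · simpa only [huv.trans hv, hv, if_true] using hF.dist_le_mul u v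
    · by_cases hu : u ≤ c
      · simp only [hu, hv, if_true, if_false]
        have h1 := hF.dist_le_mul u c
        have h2 := hG.dist_le_mul c v
        rw [hc] at h1
        have hd : ∀ a b : ℝ, a ≤ b → dist a b = b - a := fun a b hab => by
          rw [Real.dist_eq, abs_sub_comm, abs_of_nonneg (sub_nonneg.2 hab)]
        rw [hd _ _ hu] at h1
        rw [hd _ _ (not_le.1 hv).le] at h2
        rw [hd _ _ huv]
        refine (dist_triangle _ (G c) _).trans ((add_le_add h1 h2).trans (le_of_eq ?_))
        ring
      · simpa only [hu, hv, if_false] using hG.dist_le_mul u v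
  refine LipschitzWith.of_dist_le_mul fun u v => ?_
  rcases le_total u v with huv | huv
  · exact key u v huv
  · rw [dist_comm, dist_comm u]
    exact key v u huv

lemma lipschitzWith_iccExtend {σ : unitInterval → X} {m : ℝ≥0} (hσ : LipschitzWith m σ) :
    LipschitzWith m (IccExtend (zero_le_one (α := ℝ)) σ) := by
  simpa [IccExtend] using! hσ.comp (LipschitzWith.projIcc (zero_le_one (α := ℝ)))

lemma lipschitzWith_mul_unitInterval (l : ℝ) :
    LipschitzWith (Real.toNNReal |l|) (fun u : unitInterval => l * (u : ℝ)) := by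
  refine LipschitzWith.of_dist_le_mul fun u v => ?_
  rw [Real.dist_eq, ← mul_sub, abs_mul, Real.coe_toNNReal _ (abs_nonneg _), Subtype.dist_eq,
    Real.dist_eq]

/-- Excising a loop from a curve lowers its Lipschitz constant. -/
lemma exists_subcurve_excise_loop {σ : unitInterval → X} {m : ℝ≥0} (hσ : LipschitzWith m σ)
    {s t : unitInterval} (hst : s < t) (h : σ s = σ t) :
    ∃ τ, IsSubcurve σ τ ∧ LipschitzWith (m * Real.toNNReal (1 - (t - s))) τ := by
  have hst' : (s : ℝ) < t := hst
  have hs0 := s.2.1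
  have ht1 := t.2.2
  set l : ℝ := t - s with hl
  let F : ℝ → X := IccExtend zero_le_one σ
  have hF : LipschitzWith m F := lipschitzWith_iccExtend hσ
  have hFσ : ∀ u : unitInterval, F u = σ u := fun u => IccExtend_val _ _ _
  let G : ℝ → X := fun w => if w ≤ s then F w else F (w + l)
  have hG : LipschitzWith m G := by
    refine lipschitzWith_ite_le (G := fun w => F (w + l)) hF ?_ ?_
    · simpa using! hF.comp (isometry_add_right l).lipschitz
    · rw [show (s : ℝ) + l = t by linarith, hFσ, hFσ, h]
  refine ⟨fun u => G ((1 - l) * u), ⟨?_, ?_, ?_⟩, ?_⟩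
  · have : G ((1 - l) * ((0 : unitInterval) : ℝ)) = F ((0 : unitInterval) : ℝ) := by
      simp [G, hs0]
    exact this.trans (hFσ 0)
  -- `1 - l ≤ s` forces `t = 1`: the loop is then terminal, and the new curve ends at `σ s = σ 1`.
  · by_cases hc : 1 - l ≤ s
    · have ht : t = 1 := Subtype.ext (show (t : ℝ) = 1 by linarith)
      have e : G ((1 - l) * ((1 : unitInterval) : ℝ)) = F (1 - l) := by simp [G, hc]
      refine e.trans ?_
      rw [show 1 - l = s by linarith, hFσ, h, ht]
    · have e : G ((1 - l) * ((1 : unitInterval) : ℝ)) = F ((1 : unitInterval) : ℝ) := by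
        simp [G, hc]
      exact e.trans (hFσ 1)
  · rintro _ ⟨u, rfl⟩
    have : ∀ r, F r ∈ range σ := fun r => by simp [F, IccExtend]
    by_cases hc : (1 - l) * u ≤ s <;> simp [G, hc, this]
  · have := hG.comp (lipschitzWith_mul_unitInterval (1 - l))
    rwa [abs_of_nonneg (by linarith)] at this

/-- Concatenation of Lipschitz curves. -/
lemma exists_lipschitzWith_concat {σ τ : unitInterval → X} {K L : ℝ≥0} (hσ : LipschitzWith K σ)
    (hτ : LipschitzWith L τ) (h : σ 1 = τ 0) :
    ∃ (ρ : unitInterval → X) (M : ℝ≥0), LipschitzWith M ρ ∧ ρ 0 = σ 0 ∧ ρ 1 = τ 1 ∧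
      range ρ ⊆ range σ ∪ range τ := by
  let F : ℝ → X := IccExtend zero_le_one σ
  let H : ℝ → X := IccExtend zero_le_one τ
  have hF : LipschitzWith (max K L) F := (lipschitzWith_iccExtend hσ).weaken (le_max_left _ _)
  have hH : LipschitzWith (max K L) H := (lipschitzWith_iccExtend hτ).weaken (le_max_right _ _)
  let G : ℝ → X := fun w => if w ≤ 1 then F w else H (w - 1)
  have hG : LipschitzWith (max K L) G := by
    refine lipschitzWith_ite_le (G := fun w => H (w - 1)) hF ?_ ?_
    · simpa [sub_eq_add_neg] using! hH.comp (isometry_add_right (-1 : ℝ)).lipschitz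
    · simpa [F, H] using h
  refine ⟨fun u => G (2 * u), _, hG.comp (lipschitzWith_mul_unitInterval 2), ?_, ?_, ?_⟩
  · simp [G, F]
  · have : G (2 * ((1 : unitInterval) : ℝ)) = H 1 := by norm_num [G]
    exact this.trans (by simp [H])
  · rintro _ ⟨u, rfl⟩
    by_cases hc : 2 * (u : ℝ) ≤ 1 <;> simp [G, F, H, IccExtend, hc]

lemma IsMinimalSubcurve.injective {γ σ : unitInterval → X} {m : ℝ≥0}
    (h : IsMinimalSubcurve γ σ m) (hm : m ≠ 0) : Function.Injective σ := by
  have key : ∀ s t : unitInterval, s < t → σ s ≠ σ t := by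
    intro s t hst he
    obtain ⟨τ, hτ, hτL⟩ := exists_subcurve_excise_loop h.2.1 hst he
    have h1 := h.2.2 _ τ (h.1.trans hτ) hτL
    have hst' : (s : ℝ) < t := hst
    have h2 : Real.toNNReal (1 - ((t : ℝ) - s)) < 1 := by
      rw [Real.toNNReal_lt_one]; linarith
    exact absurd h1 (not_le.2 (mul_lt_of_lt_one_right (pos_iff_ne_zero.2 hm) h2))
  intro s t he
  rcases lt_trichotomy s t with h1 | h1 | h1
  · exact absurd he (key s t h1)
  · exact h1
  · exact absurd he.symm (key t s h1)

variable [MeasurableSpace X] [BorelSpace X]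

/-- The length of a curve bounds the distance of its endpoints. -/
lemma edist_le_hausdorffMeasure_image_Icc {σ : unitInterval → X} (hσ : Continuous σ)
    {s t : unitInterval} (hst : s ≤ t) :
    edist (σ s) (σ t) ≤ μH[1] (σ '' Icc s t) := by
  have hL : LipschitzWith 1 (fun z : X => dist (σ s) z) := LipschitzWith.dist_right _
  have h1 := hL.hausdorffMeasure_image_le zero_le_one (σ '' Icc s t)
  have hc : IsPreconnected ((fun z : X => dist (σ s) z) '' (σ '' Icc s t)) :=
    (isPreconnected_Icc.image _ hσ.continuousOn).image _ hL.continuous.continuousOn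
  -- The distances to `σ s` along the arc form a connected set containing both endpoints of this
  -- interval.
  have hsub : Icc 0 (dist (σ s) (σ t)) ⊆ (fun z : X => dist (σ s) z) '' (σ '' Icc s t) :=
    hc.ordConnected.out ⟨σ s, ⟨s, left_mem_Icc.2 hst, rfl⟩, dist_self _⟩
      ⟨σ t, ⟨t, right_mem_Icc.2 hst, rfl⟩, rfl⟩
  calc edist (σ s) (σ t) = volume (Icc 0 (dist (σ s) (σ t))) := by
        rw [Real.volume_Icc, sub_zero, edist_dist]
    _ = μH[1] (Icc 0 (dist (σ s) (σ t))) := by rw [hausdorffMeasure_real]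
    _ ≤ _ := measure_mono hsub
    _ ≤ _ := h1
    _ = _ := by simp

lemma hausdorffMeasure_unitInterval_Icc (s t : unitInterval) :
    μH[1] (Icc s t) = ENNReal.ofReal (t - s) := by
  have h : ((↑) : unitInterval → ℝ) '' Icc s t = Icc (s : ℝ) t := by
    ext x
    constructor
    · rintro ⟨y, hy, rfl⟩; exact hy
    · intro hx
      exact ⟨⟨x, s.2.1.trans hx.1, hx.2.trans t.2.2⟩, hx, rfl⟩
  rw [← isometry_subtype_coe.hausdorffMeasure_image (Or.inl zero_le_one), h,
    hausdorffMeasure_real, Real.volume_Icc]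

lemma hausdorffMeasure_unitInterval_univ : μH[1] (univ : Set unitInterval) = 1 := by
  have : (univ : Set unitInterval) = Icc 0 1 := by
    ext x; simp [unitInterval.le_one']
  rw [this, hausdorffMeasure_unitInterval_Icc]; simp

lemma hausdorffMeasure_image_le_mul {σ : unitInterval → X} {m : ℝ≥0} (hσ : LipschitzWith m σ)
    (B : Set unitInterval) : μH[1] (σ '' B) ≤ m * μH[1] B := by
  simpa using hσ.hausdorffMeasure_image_le zero_le_one B

lemma hausdorffMeasure_range_lt_top {σ : unitInterval → X} {m : ℝ≥0} (hσ : LipschitzWith m σ) :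
    μH[1] (range σ) < ∞ := by
  rw [← image_univ]
  refine (hausdorffMeasure_image_le_mul hσ univ).trans_lt ?_
  simp [hausdorffMeasure_unitInterval_univ]

/-- An injective Lipschitz curve has a reparametrization by arc length. -/
lemma exists_subcurve_lipschitzWith_hausdorffMeasure {σ : unitInterval → X} {m : ℝ≥0}
    (hσ : LipschitzWith m σ) (hinj : Function.Injective σ) :
    ∃ τ, IsSubcurve σ τ ∧ LipschitzWith (μH[1] (range σ)).toNNReal τ := by
  have hfin : ∀ B : Set unitInterval, μH[1] (σ '' B) ≠ ∞ := fun B =>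
    ((measure_mono (image_subset_range σ B)).trans_lt (hausdorffMeasure_range_lt_top hσ)).ne
  let V : unitInterval → ℝ := fun t => (μH[1] (σ '' Icc 0 t)).toReal
  have hadd : ∀ s t : unitInterval, s ≤ t → V t = V s + (μH[1] (σ '' Icc s t)).toReal := by
    intro s t hst
    have hU : Icc 0 t = Icc 0 s ∪ Icc s t :=
      (Icc_union_Icc_eq_Icc (show (0 : unitInterval) ≤ s from s.2.1) hst).symm
    have hI : Icc 0 s ∩ Icc s t = {s} := by
      rw [Icc_inter_Icc_eq_singleton (show (0 : unitInterval) ≤ s from s.2.1) hst]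
    have hm : MeasurableSet (σ '' Icc s t) :=
      (isCompact_Icc.image hσ.continuous).measurableSet
    -- Injectivity makes the two arcs meet in one point, which is null; hence arc length `V` is
    -- additive.
    have h0 : μH[1] (σ '' Icc 0 s ∩ σ '' Icc s t) = 0 := by
      rw [← image_inter hinj, hI, image_singleton]
      exact (Measure.nullSingletonClass_hausdorff X one_pos).measure_singleton _
    have := measure_union_add_inter (μ := μH[1]) (σ '' Icc 0 s) hm
    rw [h0, add_zero, ← image_union, ← hU] at this
    simp only [V]
    rw [this, ENNReal.toReal_add (hfin _) (hfin _)]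
  have hdist : ∀ s t : unitInterval, s ≤ t → dist (σ s) (σ t) ≤ V t - V s := by
    intro s t hst
    rw [hadd s t hst, add_sub_cancel_left, dist_edist]
    exact ENNReal.toReal_mono (hfin _) (edist_le_hausdorffMeasure_image_Icc hσ.continuous hst)
  have hdist' : ∀ s t : unitInterval, dist (σ s) (σ t) ≤ |V t - V s| := by
    intro s t
    rcases le_total s t with h | h
    · exact (hdist s t h).trans (le_abs_self _)
    · rw [dist_comm, abs_sub_comm]; exact (hdist t s h).trans (le_abs_self _)
  have hVL : LipschitzWith m V := by
    have key : ∀ s t : unitInterval, s ≤ t → |V t - V s| ≤ m * (t - s) := by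
      intro s t hst
      rw [hadd s t hst, add_sub_cancel_left, abs_of_nonneg ENNReal.toReal_nonneg]
      have h1 := hausdorffMeasure_image_le_mul hσ (Icc s t)
      rw [hausdorffMeasure_unitInterval_Icc] at h1
      have h2 := ENNReal.toReal_mono (by finiteness) h1
      rwa [ENNReal.toReal_mul, ENNReal.coe_toReal,
        ENNReal.toReal_ofReal (sub_nonneg.2 hst)] at h2
    refine LipschitzWith.of_dist_le_mul fun s t => ?_
    rw [Subtype.dist_eq, Real.dist_eq, Real.dist_eq]
    rcases le_total s t with h | h
    · rw [abs_sub_comm, abs_sub_comm (s : ℝ), abs_of_nonneg (sub_nonneg.2 h : 0 ≤ (t : ℝ) - s)]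
      exact key s t h
    · rw [abs_of_nonneg (sub_nonneg.2 h : 0 ≤ (s : ℝ) - t)]
      exact key t s h
  have hV0 : V 0 = 0 := by
    have := hadd 0 0 le_rfl
    have h' : V 0 = (μH[1] (σ '' Icc 0 0)).toReal := rfl
    linarith
  have hV1 : V 1 = ((μH[1] (range σ)).toNNReal : ℝ) := by
    have : Icc (0 : unitInterval) 1 = univ := by ext x; simp [unitInterval.le_one']
    simp only [V, this, image_univ, ENNReal.coe_toNNReal_eq_toReal]
  set L := (μH[1] (range σ)).toNNReal with hLdef
  -- Inverting `V`: any choice of `r` will do, since `hdist'` controls distances on the curve by `V`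
  -- alone.
  have hsurj : ∀ u : unitInterval, ∃ r, V r = L * u := by
    intro u
    have : (L * u : ℝ) ∈ Icc (V 0) (V 1) := by
      rw [hV0, hV1]
      exact ⟨mul_nonneg L.2 u.2.1, mul_le_of_le_one_right L.2 u.2.2⟩
    have hp := (isPreconnected_univ (α := unitInterval)).intermediate_value
      (mem_univ 0) (mem_univ 1) hVL.continuous.continuousOn this
    obtain ⟨r, -, hr⟩ := hp
    exact ⟨r, hr⟩
  choose r hr using hsurj
  refine ⟨σ ∘ r, ⟨?_, ?_, range_comp_subset_range r σ⟩, LipschitzWith.of_dist_le_mul fun u v => ?_⟩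
  · have := hdist' (r 0) 0
    rw [hr, hV0] at this
    simpa using this
  · have := hdist' (r 1) 1
    rw [hr, hV1] at this
    simpa using this
  · have := hdist' (r u) (r v)
    rwa [hr, hr, ← mul_sub, abs_mul, NNReal.abs_eq, abs_sub_comm] at this

/-- The arc length parametrization is a competitor whose constant is the length. A constant curve
(`m = 0`) need not be treated as injective. -/
lemma IsMinimalSubcurve.le_hausdorffMeasure {γ σ : unitInterval → X} {m : ℝ≥0}
    (h : IsMinimalSubcurve γ σ m) : m ≤ μH[1] (range σ) := by
  rcases eq_or_ne m 0 with rfl | hm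
  · simp
  obtain ⟨τ, hτ, hτL⟩ := exists_subcurve_lipschitzWith_hausdorffMeasure h.2.1 (h.injective hm)
  calc (m : ℝ≥0∞) ≤ (μH[1] (range σ)).toNNReal := by
        exact_mod_cast h.2.2 _ τ (h.1.trans hτ) hτL
    _ ≤ _ := ENNReal.coe_toNNReal_le_self

/-- A curve whose image is as long as its Lipschitz constant has constant speed. -/
lemma hausdorffMeasure_image_eq_mul {σ : unitInterval → X} {m : ℝ≥0} (hσ : LipschitzWith m σ)
    (hm : m ≤ μH[1] (range σ)) {B : Set unitInterval} (hB : MeasurableSet B) :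
    μH[1] (σ '' B) = m * μH[1] B := by
  refine le_antisymm (hausdorffMeasure_image_le_mul hσ B) ?_
  have hBc : μH[1] B + μH[1] Bᶜ = 1 := by
    rw [measure_add_measure_compl hB, hausdorffMeasure_unitInterval_univ]
  have hfin : m * μH[1] Bᶜ ≠ ∞ := by
    have : μH[1] Bᶜ ≤ 1 := hBc ▸ le_add_self
    exact ENNReal.mul_ne_top ENNReal.coe_ne_top (this.trans_lt ENNReal.one_lt_top).ne
  -- The upper bounds on `B` and `Bᶜ` add up to `m`, already attained by the whole range, so neither
  -- has slack.
  refine (ENNReal.add_le_add_iff_right hfin).1 ?_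
  calc m * μH[1] B + m * μH[1] Bᶜ = m := by rw [← mul_add, hBc, mul_one]
    _ ≤ μH[1] (range σ) := hm
    _ = μH[1] (σ '' B ∪ σ '' Bᶜ) := by rw [← image_union, union_compl_self, image_univ]
    _ ≤ μH[1] (σ '' B) + μH[1] (σ '' Bᶜ) := measure_union_le _ _
    _ ≤ _ := by gcongr; exact hausdorffMeasure_image_le_mul hσ Bᶜ

end Curves

/-! ### Semicontinuity of integrals and compactness of curves -/

/-- Layer cake formula for functions with values in `[0, ∞]`. -/
lemma lintegral_eq_lintegral_meas_ofReal_lt {α : Type*} [MeasurableSpace α] (μ : Measure α)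
    [SFinite μ] {f : α → ℝ≥0∞} (hf : Measurable f) :
    ∫⁻ x, f x ∂μ = ∫⁻ t in Ioi (0 : ℝ), μ {x | ENNReal.ofReal t < f x} := by
  have hc : ∀ c : ℝ≥0∞,
      ∫⁻ t in Ioi (0 : ℝ), {t : ℝ | ENNReal.ofReal t < c}.indicator 1 t = c := by
    intro c
    have hm : MeasurableSet {t : ℝ | ENNReal.ofReal t < c} :=
      measurableSet_lt ENNReal.measurable_ofReal measurable_const
    rw [lintegral_indicator_one hm, Measure.restrict_apply hm]
    induction c with
    | top => simp
    | coe c =>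
      have : {t : ℝ | ENNReal.ofReal t < c} ∩ Ioi 0 = Ioo 0 (c : ℝ) := by
        ext t
        simp only [mem_inter_iff, mem_ofPred_eq, mem_Ioi, mem_Ioo]
        rw [and_comm]
        refine and_congr_right fun ht => ?_
        rw [ENNReal.ofReal, ENNReal.coe_lt_coe, Real.toNNReal_lt_iff_lt_coe ht.le]
      rw [this, Real.volume_Ioo, sub_zero, ENNReal.ofReal_coe_nnreal]
  have hm : MeasurableSet {p : α × ℝ | ENNReal.ofReal p.2 < f p.1} :=
    measurableSet_lt (ENNReal.measurable_ofReal.comp measurable_snd) (hf.comp measurable_fst)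
  calc ∫⁻ x, f x ∂μ
      = ∫⁻ x, (∫⁻ t in Ioi (0 : ℝ),
          {p : α × ℝ | ENNReal.ofReal p.2 < f p.1}.indicator (fun _ => 1) (x, t)) ∂μ :=
        lintegral_congr fun x => (hc (f x)).symm
    _ = ∫⁻ t in Ioi (0 : ℝ), (∫⁻ x,
          {p : α × ℝ | ENNReal.ofReal p.2 < f p.1}.indicator (fun _ => 1) (x, t) ∂μ) :=
        lintegral_lintegral_swap
          (f := fun x t => {p : α × ℝ | ENNReal.ofReal p.2 < f p.1}.indicator (fun _ => 1) (x, t))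
          (measurable_const.indicator hm).aemeasurable
    _ = _ := by
        refine lintegral_congr fun t => ?_
        exact lintegral_indicator_one (s := {x | ENNReal.ofReal t < f x})
          (measurableSet_lt measurable_const hf)

/-- Lower semicontinuity of integrals from lower semicontinuity on superlevel sets. -/
lemma lintegral_le_liminf_lintegral_of_meas_lt {α ι : Type*} [MeasurableSpace α] {u : Filter ι}
    [u.IsCountablyGenerated] {μ : Measure α} [SFinite μ] {ν : ι → Measure α}
    [∀ k, SFinite (ν k)] {f : α → ℝ≥0∞} (hf : Measurable f)
    (h : ∀ t : ℝ, μ {x | ENNReal.ofReal t < f x} ≤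
      liminf (fun k => ν k {x | ENNReal.ofReal t < f x}) u) :
    ∫⁻ x, f x ∂μ ≤ liminf (fun k => ∫⁻ x, f x ∂(ν k)) u := by
  simp only [lintegral_eq_lintegral_meas_ofReal_lt _ hf]
  -- Fatou in the level `t`; measurability comes from monotonicity in `t`.
  refine (lintegral_mono h).trans (lintegral_liminf_le fun k => Antitone.measurable ?_)
  intro s t hst
  exact measure_mono fun x hx => lt_of_le_of_lt (ENNReal.ofReal_le_ofReal hst) hx

/-- Curves with bounded Lipschitz constants and convergent endpoints subconverge together with
their Lipschitz constants. -/
lemma exists_subseq_tendsto_of_tendsto_endpoints {X : Type*} [MetricSpace X] [ProperSpace X]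
    {σ : ℕ → unitInterval → X} {m : ℕ → ℝ≥0}
    (hσ : ∀ k, LipschitzWith (m k) (σ k)) {M : ℝ≥0} (hM : ∀ k, m k ≤ M) {x y : X}
    (hx : Tendsto (fun k => σ k 0) atTop (𝓝 x)) (hy : Tendsto (fun k => σ k 1) atTop (𝓝 y)) :
    ∃ (g : unitInterval → X) (r : ℝ≥0) (φ : ℕ → ℕ), StrictMono φ ∧ g 0 = x ∧ g 1 = y ∧
      Tendsto (fun k => m (φ k)) atTop (𝓝 r) ∧
      ∀ t, Tendsto (fun k => σ (φ k) t) atTop (𝓝 (g t)) := by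
  -- Each curve stays within `M` of its starting point, and the starting points together with their
  -- limit are compact.
  have hK : IsCompact (Metric.cthickening M (insert x (range fun k => σ k 0))) :=
    hx.isCompact_insert_range.cthickening
  obtain ⟨r, -, ψ, hψ, hr⟩ := isCompact_Icc.tendsto_subseq (x := m)
    (fun k => (⟨zero_le, hM k⟩ : m k ∈ Icc 0 M))
  obtain ⟨g, φ, hφ, hg⟩ := exists_subseq_tendsto_of_lipschitzWith hK (M := M)
    (f := fun k => σ (ψ k)) (fun k => (hσ _).weaken (hM _)) (by
      intro k t
      refine Metric.mem_cthickening_of_dist_le _ (σ (ψ k) 0) _ _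
        (mem_insert_of_mem _ (mem_range_self _)) ?_
      refine ((hσ _).dist_le_mul t 0).trans ?_
      have h1 : dist t 0 ≤ 1 := by
        rw [Subtype.dist_eq, Real.dist_eq]
        simpa [abs_of_nonneg t.2.1] using t.2.2
      calc (m (ψ k) : ℝ) * dist t 0 ≤ M * 1 :=
            mul_le_mul (by exact_mod_cast hM _) h1 dist_nonneg M.2
        _ = M := mul_one _)
  have hψφ : Tendsto (fun k => ψ (φ k)) atTop atTop := (hψ.comp hφ).tendsto_atTop
  exact ⟨g, r, ψ ∘ φ, hψ.comp hφ, tendsto_nhds_unique (hg 0) (hx.comp hψφ),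
    tendsto_nhds_unique (hg 1) (hy.comp hψφ), hr.comp hφ.tendsto_atTop, hg⟩

/-! ### Gołąb-type semicontinuity of length -/

section Golab

variable {X : Type*} [MetricSpace X] [MeasurableSpace X] [BorelSpace X]
  {σ : ℕ → unitInterval → X} {m : ℕ → ℝ≥0} {γ : unitInterval → X} {l : ℝ≥0}

/-- Lower semicontinuity of length in open sets, along curves of constant speed. -/
lemma hausdorffMeasure_range_inter_le_liminf (hσ : ∀ k, LipschitzWith (m k) (σ k))
    (hm : ∀ k, m k ≤ μH[1] (range (σ k))) (hl : Tendsto m atTop (𝓝 l))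
    (hγ : ∀ t, Tendsto (fun k => σ k t) atTop (𝓝 (γ t))) {U : Set X} (hU : IsOpen U) :
    μH[1] (range γ ∩ U) ≤ liminf (fun k => μH[1] (range (σ k) ∩ U)) atTop := by
  have hγL : LipschitzWith l γ := lipschitzWith_of_tendsto hσ hl hγ
  have hmeas : ∀ k, MeasurableSet (σ k ⁻¹' U) := fun k =>
    (hU.preimage (hσ k).continuous).measurableSet
  have hk : ∀ k, ∫⁻ t, (σ k ⁻¹' U).indicator (fun _ => (m k : ℝ≥0∞)) t ∂μH[1] =
      μH[1] (range (σ k) ∩ U) := by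
    intro k
    rw [lintegral_indicator_const (hmeas k), ← hausdorffMeasure_image_eq_mul (hσ k) (hm k) (hmeas k),
      image_preimage_eq_range_inter]
  calc μH[1] (range γ ∩ U) = μH[1] (γ '' (γ ⁻¹' U)) := by rw [image_preimage_eq_range_inter]
    _ ≤ l * μH[1] (γ ⁻¹' U) := hausdorffMeasure_image_le_mul hγL _
    _ = ∫⁻ t, (γ ⁻¹' U).indicator (fun _ => (l : ℝ≥0∞)) t ∂μH[1] := by
        rw [lintegral_indicator_const (hU.preimage hγL.continuous).measurableSet]
    -- Since `U` is open, `γ t ∈ U` implies `σ k t ∈ U` eventually.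
    _ ≤ ∫⁻ t, liminf (fun k => (σ k ⁻¹' U).indicator (fun _ => (m k : ℝ≥0∞)) t) atTop ∂μH[1] := by
        refine lintegral_mono fun t => ?_
        by_cases ht : t ∈ γ ⁻¹' U
        · rw [indicator_of_mem ht]
          have hev : ∀ᶠ k in atTop, σ k t ∈ U := (hγ t).eventually (hU.mem_nhds ht)
          refine (Tendsto.liminf_eq ?_).ge
          refine (ENNReal.tendsto_coe.2 hl).congr' ?_
          filter_upwards [hev] with k hk
          rw [indicator_of_mem (show t ∈ σ k ⁻¹' U from hk)]
        · rw [indicator_of_notMem ht]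
          exact zero_le
    _ ≤ liminf (fun k => ∫⁻ t, (σ k ⁻¹' U).indicator (fun _ => (m k : ℝ≥0∞)) t ∂μH[1]) atTop :=
        lintegral_liminf_le fun k => measurable_const.indicator (hmeas k)
    _ = _ := by simp only [hk]

/-- Lower semicontinuity of length outside a set of finite length. -/
lemma hausdorffMeasure_range_sdiff_le_liminf [ProperSpace X]
    (hσ : ∀ k, LipschitzWith (m k) (σ k))
    (hm : ∀ k, m k ≤ μH[1] (range (σ k))) (hl : Tendsto m atTop (𝓝 l))
    (hγ : ∀ t, Tendsto (fun k => σ k t) atTop (𝓝 (γ t))) {A : Set X} (hA : MeasurableSet A)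
    (hfin : μH[1] A < ∞) :
    μH[1] (range γ \ A) ≤ liminf (fun k => μH[1] (range (σ k) \ A)) atTop := by
  refine ENNReal.le_of_forall_pos_le_add fun ε hε _ => ?_
  have : IsFiniteMeasure (μH[1].restrict A : Measure X) := ⟨by simpa using hfin⟩
  -- Replacing `A` by a compact `K` makes the complement open, at the price of length `ε` uniformly
  -- in `k`.
  obtain ⟨K, hKA, hK, hKε⟩ := hA.exists_isCompact_sdiff_lt
    (measure_ne_top (μH[1].restrict A) A) (ENNReal.coe_ne_zero.2 hε.ne')
  rw [Measure.restrict_apply (hA.diff hK.measurableSet),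
    inter_eq_left.2 sdiff_subset] at hKε
  calc μH[1] (range γ \ A) ≤ μH[1] (range γ ∩ Kᶜ) :=
        measure_mono fun x hx => ⟨hx.1, fun h => hx.2 (hKA h)⟩
    _ ≤ liminf (fun k => μH[1] (range (σ k) ∩ Kᶜ)) atTop :=
        hausdorffMeasure_range_inter_le_liminf hσ hm hl hγ hK.isClosed.isOpen_compl
    _ ≤ liminf (fun k => μH[1] (range (σ k) \ A) + ε) atTop := by
        refine liminf_le_liminf (Eventually.of_forall fun k => ?_)
        calc μH[1] (range (σ k) ∩ Kᶜ) ≤ μH[1] ((range (σ k) \ A) ∪ (A \ K)) := by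
              refine measure_mono fun x hx => ?_
              by_cases hxA : x ∈ A
              · exact Or.inr ⟨hxA, hx.2⟩
              · exact Or.inl ⟨hx.1, hxA⟩
          _ ≤ μH[1] (range (σ k) \ A) + μH[1] (A \ K) := measure_union_le _ _
          _ ≤ _ := by gcongr
    _ = liminf (fun k => μH[1] (range (σ k) \ A)) atTop + ε := by
        refine (Monotone.map_liminf_of_continuousAt (f := fun x : ℝ≥0∞ => x + ε) ?_ _ ?_).symm
        · intro a b hab; exact add_le_add_left hab _
        · exact (continuous_id.add continuous_const).continuousAt

end Golab

/-! ### Weak compactness of transport plans -/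

lemma isCompact_hypercube (n : ℕ) : IsCompact (hypercube n) := by
  have h : IsCompact (univ.pi fun _ : Fin n => Icc (-1 : ℝ) 1) :=
    isCompact_univ_pi fun _ => isCompact_Icc
  have h' := h.image (PiLp.continuous_toLp 2 fun _ : Fin n => ℝ)
  convert h' using 1
  ext x
  constructor
  · intro hx
    exact ⟨x.ofLp, fun i _ => hx i, rfl⟩
  · rintro ⟨y, hy, rfl⟩ i
    exact hy i (mem_univ i)

/-- Probability measures on a product whose marginals live on a compact set form a compact set. -/
lemma isCompact_setOf_map_fst_snd_eq {X : Type*} [MetricSpace X] [SecondCountableTopology X]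
    [MeasurableSpace X] [BorelSpace X] {K : Set X} (hK : IsCompact K) {μ ν : ProbabilityMeasure X}
    (hμ : (μ : Measure X) Kᶜ = 0) (hν : (ν : Measure X) Kᶜ = 0) :
    IsCompact {π : ProbabilityMeasure (X × X) |
      π.map measurable_fst.aemeasurable = μ ∧ π.map measurable_snd.aemeasurable = ν} := by
  -- Tightness with constant sequences: no plan has mass outside `K ×ˢ K`.
  have hc := isCompact_setOfPred_probabilityMeasure_mass_eq_compl_isCompact_le (E := X × X)
    (u := fun _ => 0) (K := fun _ => K ×ˢ K) tendsto_const_nhds (fun _ => hK.prod hK)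
    (Or.inl inferInstance)
  refine hc.of_isClosed_subset ?_ ?_
  · exact (isClosed_singleton.preimage (ProbabilityMeasure.continuous_map continuous_fst)).inter
      (isClosed_singleton.preimage (ProbabilityMeasure.continuous_map continuous_snd))
  · rintro π ⟨h1, h2⟩ _
    have hKm := hK.measurableSet
    have e1 : (π : Measure (X × X)) (Prod.fst ⁻¹' Kᶜ) = 0 := by
      rw [← Measure.map_apply measurable_fst hKm.compl, ← hμ, ← h1]; rfl
    have e2 : (π : Measure (X × X)) (Prod.snd ⁻¹' Kᶜ) = 0 := by
      rw [← Measure.map_apply measurable_snd hKm.compl, ← hν, ← h2]; rfl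
    have : (π : Measure (X × X)) (K ×ˢ K)ᶜ = 0 := by
      rw [compl_prod_eq_union, measure_union_null_iff]
      exact ⟨by simpa [prod_univ] using e1, by simpa [univ_prod] using e2⟩
    simp [ProbabilityMeasure.coeFn_def, this]

lemma lowerSemicontinuous_lintegral {X : Type*} [MetricSpace X] [SecondCountableTopology X]
    [MeasurableSpace X] [BorelSpace X] {f : X → ℝ≥0∞} (hf : LowerSemicontinuous f) :
    LowerSemicontinuous fun π : ProbabilityMeasure X => ∫⁻ x, f x ∂(π : Measure X) := by
  intro π
  refine lowerSemicontinuousAt_iff_le_liminf.2 ?_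
  exact lintegral_le_liminf_lintegral_of_meas_lt hf.measurable fun t =>
    ProbabilityMeasure.le_liminf_measure_open_of_tendsto tendsto_id (hf.isOpen_preimage _)

/-! ### Lower semicontinuity of the urban metric -/

section UrbanMetric

variable {n : ℕ} {S : Set (E n)} {a : ℝ≥0∞} {b : E n → ℝ≥0∞}

open Classical in
/-- The travel cost per unit length: `b` on the network and `a` off it. -/
noncomputable def costDensity (S : Set (E n)) (a : ℝ≥0∞) (b : E n → ℝ≥0∞) : E n → ℝ≥0∞ :=
  S.piecewise b fun _ => a

lemma costDensity_of_mem {z : E n} (hz : z ∈ S) : costDensity S a b z = b z := by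
  classical exact piecewise_eq_of_mem _ _ _ hz

lemma costDensity_of_notMem {z : E n} (hz : z ∉ S) : costDensity S a b z = a := by
  classical exact piecewise_eq_of_notMem _ _ _ hz

/-- A single density makes the cost monotone in the range and accessible to the layer cake formula.
-/
lemma pathCost_eq_lintegral (hS : MeasurableSet S) (γ : unitInterval → E n) :
    pathCost S a b γ = ∫⁻ z in range γ, costDensity S a b z ∂(H1 n) := by
  rw [← lintegral_inter_add_sdiff _ (range γ) hS, pathCost]
  congr 1
  · refine (lintegral_congr_ae ?_).symm
    filter_upwards [ae_restrict_of_ae_restrict_of_subset inter_subset_right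
      (ae_restrict_mem hS)] with z hz
    exact costDensity_of_mem hz
  · have hz : ∀ᵐ z ∂(H1 n).restrict (range γ \ S), costDensity S a b z = a := by
      filter_upwards [ae_restrict_of_ae_restrict_of_subset (fun _ hz => hz.2)
        (ae_restrict_mem hS.compl)] with z hz
      exact costDensity_of_notMem hz
    rw [lintegral_congr_ae hz, setLIntegral_const]

lemma costDensity_le (hba : ∀ z ∈ S, b z ≤ a) (z : E n) : costDensity S a b z ≤ a := by
  by_cases hz : z ∈ S
  · rw [costDensity_of_mem hz]; exact hba z hz
  · rw [costDensity_of_notMem hz]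

lemma measurableSet_subNetwork (hS : MeasurableSet S) (hb : LowerSemicontinuousOn b S)
    (l : ℝ≥0∞) : MeasurableSet (subNetwork S b l) := by
  obtain ⟨v, hv, h⟩ := lowerSemicontinuousOn_iff_preimage_Iic.1 hb l
  have : subNetwork S b l = S ∩ v := h
  rw [this]
  exact hS.inter hv.measurableSet

/-- Off `S` the density is `a > l`. Thus the finite length assumption on `S_l` concerns exactly the
complements of superlevel sets. -/
lemma setOf_lt_costDensity {l : ℝ≥0∞} (hl : l < a) :
    {z | l < costDensity S a b z} = (subNetwork S b l)ᶜ := by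
  ext z
  by_cases hz : z ∈ S
  · simp [costDensity_of_mem hz, subNetwork, hz]
  · simp [costDensity_of_notMem hz, subNetwork, hz, hl]

lemma measurable_costDensity (hS : MeasurableSet S) (hb : LowerSemicontinuousOn b S)
    (hba : ∀ z ∈ S, b z ≤ a) : Measurable (costDensity S a b) := by
  refine measurable_of_Ioi fun l => ?_
  rcases lt_or_ge l a with hl | hl
  · have : costDensity S a b ⁻¹' Ioi l = (subNetwork S b l)ᶜ := setOf_lt_costDensity hl
    rw [this]
    exact (measurableSet_subNetwork hS hb l).compl
  · have : costDensity S a b ⁻¹' Ioi l = ∅ := by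
      ext z
      simpa using (costDensity_le hba z).trans hl
    rw [this]
    exact MeasurableSet.empty

lemma pathCost_mono (hS : MeasurableSet S) {γ σ : unitInterval → E n} (h : range σ ⊆ range γ) :
    pathCost S a b σ ≤ pathCost S a b γ := by
  rw [pathCost_eq_lintegral hS, pathCost_eq_lintegral hS]
  exact lintegral_mono_set h

/-! ### Finite `a`: comparison with the Euclidean distance -/

section FiniteCost

lemma pathCost_le_mul_hausdorffMeasure (hS : MeasurableSet S) (hba : ∀ z ∈ S, b z ≤ a)
    (γ : unitInterval → E n) : pathCost S a b γ ≤ a * H1 n (range γ) := by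
  rw [pathCost_eq_lintegral hS, ← setLIntegral_const]
  exact lintegral_mono (costDensity_le hba)

lemma urbanMetric_le_mul_edist (hS : MeasurableSet S) (hba : ∀ z ∈ S, b z ≤ a) (x y : E n) :
    urbanMetric S a b x y ≤ a * edist x y := by
  let γ : unitInterval → E n := fun t => AffineMap.lineMap x y (t : ℝ)
  have hγ : LipschitzWith (nndist x y) γ := by
    simpa using! (lipschitzWith_lineMap x y).comp (LipschitzWith.subtype_val _)
  calc urbanMetric S a b x y ≤ pathCost S a b γ :=
        iInf₂_le γ ⟨⟨_, hγ⟩, by simp [γ], by simp [γ]⟩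
    _ ≤ a * H1 n (range γ) := pathCost_le_mul_hausdorffMeasure hS hba γ
    _ ≤ a * edist x y := by
        gcongr
        rw [← image_univ, edist_nndist]
        simpa [hausdorffMeasure_unitInterval_univ] using hausdorffMeasure_image_le_mul hγ univ

lemma urbanMetric_triangle (hS : MeasurableSet S) (x y z : E n) :
    urbanMetric S a b x z ≤ urbanMetric S a b x y + urbanMetric S a b y z := by
  simp only [urbanMetric, ENNReal.iInf_add, ENNReal.add_iInf]
  refine le_iInf₂ fun τ hτ => le_iInf₂ fun σ hσ => ?_
  obtain ⟨⟨K, hK⟩, hσ0, hσ1⟩ := hσ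
  obtain ⟨⟨L, hL⟩, hτ0, hτ1⟩ := hτ
  obtain ⟨ρ, M, hM, hρ0, hρ1, hρ⟩ := exists_lipschitzWith_concat hK hL (hσ1.trans hτ0.symm)
  refine (iInf₂_le ρ ⟨⟨M, hM⟩, hρ0.trans hσ0, hρ1.trans hτ1⟩).trans ?_
  simp only [pathCost_eq_lintegral hS]
  exact (lintegral_mono_set hρ).trans (lintegral_union_le _ _ _)

lemma isClosed_setOf_urbanMetric_le_of_lt_top (hS : MeasurableSet S) (hba : ∀ z ∈ S, b z ≤ a)
    (ha : a < ∞) (c : ℝ≥0∞) : IsClosed {p : E n × E n | urbanMetric S a b p.1 p.2 ≤ c} := by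
  refine IsSeqClosed.isClosed fun p q hp hq => ?_
  have h1 : Tendsto (fun k => edist q.1 (p k).1) atTop (𝓝 0) := by
    simpa using (tendsto_const_nhds (x := q.1)).edist (hq.fst_nhds)
  have h2 : Tendsto (fun k => edist (p k).2 q.2) atTop (𝓝 0) := by
    simpa using hq.snd_nhds.edist (tendsto_const_nhds (x := q.2))
  -- The detour `q.1 → (p k).1 → (p k).2 → q.2` bounds the metric at `q`; finiteness of `a` lets the
  -- two end terms vanish.
  have h3 : Tendsto (fun k => a * edist q.1 (p k).1 + (c + a * edist (p k).2 q.2)) atTop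
      (𝓝 (a * 0 + (c + a * 0))) :=
    (ENNReal.Tendsto.const_mul h1 (Or.inr ha.ne)).add
      (tendsto_const_nhds.add (ENNReal.Tendsto.const_mul h2 (Or.inr ha.ne)))
  simp only [mul_zero, add_zero, zero_add] at h3
  refine ge_of_tendsto' h3 fun k => ?_
  refine (urbanMetric_triangle hS q.1 (p k).1 q.2).trans ?_
  refine add_le_add (urbanMetric_le_mul_edist hS hba _ _) ?_
  exact (urbanMetric_triangle hS _ (p k).2 _).trans
    (add_le_add (hp k) (urbanMetric_le_mul_edist hS hba _ _))

end FiniteCost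

/-! ### Infinite `a`: limits of almost optimal paths -/

section InfiniteCost

/-- Lower semicontinuity of the path cost along curves of constant speed. -/
lemma pathCost_le_liminf (hS : MeasurableSet S) (hb : LowerSemicontinuousOn b S)
    (hfin : ∀ l < ∞, H1 n (subNetwork S b l) < ∞)
    {σ : ℕ → unitInterval → E n} {m : ℕ → ℝ≥0} {γ : unitInterval → E n} {r : ℝ≥0}
    (hσ : ∀ k, LipschitzWith (m k) (σ k)) (hm : ∀ k, m k ≤ H1 n (range (σ k)))
    (hr : Tendsto m atTop (𝓝 r)) (hγ : ∀ t, Tendsto (fun k => σ k t) atTop (𝓝 (γ t))) :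
    pathCost S ∞ b γ ≤ liminf (fun k => pathCost S ∞ b (σ k)) atTop := by
  simp only [pathCost_eq_lintegral hS]
  have hγL : LipschitzWith r γ := lipschitzWith_of_tendsto hσ hr hγ
  have : IsFiniteMeasure ((H1 n).restrict (range γ)) :=
    ⟨by simpa using hausdorffMeasure_range_lt_top hγL⟩
  have (k : ℕ) : IsFiniteMeasure ((H1 n).restrict (range (σ k))) :=
    ⟨by simpa using hausdorffMeasure_range_lt_top (hσ k)⟩
  refine lintegral_le_liminf_lintegral_of_meas_lt
    (measurable_costDensity hS hb fun _ _ => le_top) fun t => ?_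
  have hA := measurableSet_subNetwork hS hb (ENNReal.ofReal t)
  rw [setOf_lt_costDensity ENNReal.ofReal_lt_top]
  simp only [Measure.restrict_apply hA.compl, inter_comm (subNetwork _ _ _)ᶜ, ← sdiff_eq]
  exact hausdorffMeasure_range_sdiff_le_liminf hσ hm hr hγ hA (hfin _ ENNReal.ofReal_lt_top)

/-- The length of a path is controlled by its cost. -/
lemma hausdorffMeasure_range_le_add_pathCost (hS : MeasurableSet S)
    (hb : LowerSemicontinuousOn b S) (γ : unitInterval → E n) :
    H1 n (range γ) ≤ H1 n (subNetwork S b 1) + pathCost S ∞ b γ := by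
  have hA := measurableSet_subNetwork hS hb 1
  calc H1 n (range γ) ≤ H1 n (subNetwork S b 1 ∪ range γ \ subNetwork S b 1) :=
        measure_mono fun x hx => by
          by_cases h : x ∈ subNetwork S b 1
          · exact Or.inl h
          · exact Or.inr ⟨hx, h⟩
    _ ≤ H1 n (subNetwork S b 1) + H1 n (range γ \ subNetwork S b 1) := measure_union_le _ _
    _ ≤ _ := by
        gcongr
        rw [pathCost_eq_lintegral hS, sdiff_eq, inter_comm, ← Measure.restrict_apply hA.compl,
          ← setOf_lt_costDensity ENNReal.one_lt_top]
        -- Markov's inequality: off `S_1` each unit of length costs at least `1`.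
        have h1 := mul_meas_ge_le_lintegral (μ := (H1 n).restrict (range γ))
          (measurable_costDensity hS hb fun _ _ => le_top) 1
        rw [one_mul] at h1
        exact (measure_mono fun z (hz : 1 < costDensity S ∞ b z) => hz.le).trans h1

lemma isClosed_setOf_urbanMetric_le_of_top (hS : MeasurableSet S)
    (hb : LowerSemicontinuousOn b S) (hfin : ∀ l < ∞, H1 n (subNetwork S b l) < ∞) (c : ℝ≥0∞) :
    IsClosed {p : E n × E n | urbanMetric S ∞ b p.1 p.2 ≤ c} := by
  rcases eq_or_ne c ∞ with rfl | hc
  · simp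
  refine IsSeqClosed.isClosed fun p q hp hq => ?_
  -- The slack `1/(k+1)` vanishes in the limit and is at most `1`, whence the uniform cost bound `c
  -- + 1` below.
  have hex : ∀ k, ∃ γ ∈ lipschitzPaths (p k).1 (p k).2,
      pathCost S ∞ b γ < c + ((k : ℝ≥0∞) + 1)⁻¹ := by
    intro k
    have : urbanMetric S ∞ b (p k).1 (p k).2 < c + ((k : ℝ≥0∞) + 1)⁻¹ :=
      (hp k).trans_lt (ENNReal.lt_add_right hc (by simp))
    simpa only [urbanMetric, iInf_lt_iff, exists_prop] using this
  choose γ hγ hγc using hex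
  have hmin : ∀ k, ∃ (σ : unitInterval → E n) (m : ℝ≥0), IsMinimalSubcurve (γ k) σ m := fun k =>
    exists_isMinimalSubcurve (hγ k).1.choose_spec
  choose σ m hσ using hmin
  have hm : ∀ k, m k ≤ H1 n (range (σ k)) := fun k => (hσ k).le_hausdorffMeasure
  have hcost : ∀ k, pathCost S ∞ b (σ k) ≤ c + ((k : ℝ≥0∞) + 1)⁻¹ := fun k =>
    (pathCost_mono hS (hσ k).1.2.2).trans (hγc k).le
  have hM : H1 n (subNetwork S b 1) + (c + 1) ≠ ∞ := by
    have := (hfin 1 ENNReal.one_lt_top).ne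
    finiteness
  have hbd : ∀ k, m k ≤ (H1 n (subNetwork S b 1) + (c + 1)).toNNReal := by
    intro k
    rw [← ENNReal.coe_le_coe, ENNReal.coe_toNNReal hM]
    refine (hm k).trans ((hausdorffMeasure_range_le_add_pathCost hS hb (σ k)).trans ?_)
    gcongr
    refine (hcost k).trans ?_
    gcongr
    simp
  obtain ⟨g, r, φ, hφ, hg0, hg1, hr, hg⟩ := exists_subseq_tendsto_of_tendsto_endpoints
    (fun k => (hσ k).2.1) hbd (x := q.1) (y := q.2)
    (by simpa only [(hσ _).1.1, (hγ _).2.1] using hq.fst_nhds)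
    (by simpa only [(hσ _).1.2.1, (hγ _).2.2] using hq.snd_nhds)
  have hgL : LipschitzWith r g := lipschitzWith_of_tendsto (fun k => (hσ (φ k)).2.1) hr hg
  have hlim : Tendsto (fun k => c + ((φ k : ℝ≥0∞) + 1)⁻¹) atTop (𝓝 c) := by
    have h1 : Tendsto (fun k : ℕ => ((k : ℝ≥0∞) + 1)⁻¹) atTop (𝓝 0) := by
      have := (tendsto_add_atTop_iff_nat 1).2 ENNReal.tendsto_inv_nat_nhds_zero
      simpa using this
    simpa using tendsto_const_nhds.add (h1.comp hφ.tendsto_atTop)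
  calc urbanMetric S ∞ b q.1 q.2 ≤ pathCost S ∞ b g := iInf₂_le g ⟨⟨r, hgL⟩, hg0, hg1⟩
    _ ≤ liminf (fun k => pathCost S ∞ b (σ (φ k))) atTop :=
        pathCost_le_liminf hS hb hfin (fun k => (hσ (φ k)).2.1) (fun k => hm (φ k)) hr hg
    _ ≤ liminf (fun k => c + ((φ k : ℝ≥0∞) + 1)⁻¹) atTop :=
        liminf_le_liminf (Eventually.of_forall fun k => hcost (φ k))
    _ = c := hlim.liminf_eq

end InfiniteCost

lemma lowerSemicontinuous_urbanMetric (hS : MeasurableSet S) (hb : LowerSemicontinuousOn b S)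
    (hba : ∀ z ∈ S, b z ≤ a) (h : a < ∞ ∨ ∀ l : ℝ≥0∞, l < a → H1 n (subNetwork S b l) < ∞) :
    LowerSemicontinuous fun p : E n × E n => urbanMetric S a b p.1 p.2 := by
  refine lowerSemicontinuous_iff_isClosed_preimage.2 fun c => ?_
  rcases lt_or_ge a ∞ with ha | ha
  · exact isClosed_setOf_urbanMetric_le_of_lt_top hS hba ha c
  · obtain rfl : a = ∞ := top_le_iff.1 ha
    exact isClosed_setOf_urbanMetric_le_of_top hS hb (h.resolve_left (lt_irrefl _)) c

end UrbanMetric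

end UrbanPlanning

/-! ### Existence of an optimal plan -/

theorem mainTheorem12 (n : ℕ) (S : Set (UrbanPlanning.E n)) (hSC : S ⊆ UrbanPlanning.hypercube n)
    (hSmeas : MeasurableSet S) (hSrect : UrbanPlanning.CountablyOneRectifiable S)
    (a : ENNReal) (b : UrbanPlanning.E n → ENNReal)
    (hb : LowerSemicontinuousOn b S) (hba : ∀ z ∈ S, b z ≤ a)
    (μp μm : MeasureTheory.Measure (UrbanPlanning.E n))
    (hμp : MeasureTheory.IsProbabilityMeasure μp) (hμm : MeasureTheory.IsProbabilityMeasure μm)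
    (hμpC : μp (UrbanPlanning.hypercube n)ᶜ = 0) (hμmC : μm (UrbanPlanning.hypercube n)ᶜ = 0)
    (h : a < ⊤ ∨ ∀ l : ENNReal, l < a → UrbanPlanning.H1 n (UrbanPlanning.subNetwork S b l) < ⊤) :
    ∃ π ∈ UrbanPlanning.transportPlans μp μm,
      UrbanPlanning.wassersteinDist S a b μp μm =
        ∫⁻ p, UrbanPlanning.urbanMetric S a b p.1 p.2 ∂π := by
  have hlsc := UrbanPlanning.lowerSemicontinuous_urbanMetric hSmeas hb hba h
  let μ : ProbabilityMeasure (UrbanPlanning.E n) := ⟨μp, hμp⟩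
  let ν : ProbabilityMeasure (UrbanPlanning.E n) := ⟨μm, hμm⟩
  have hc := UrbanPlanning.isCompact_setOf_map_fst_snd_eq (UrbanPlanning.isCompact_hypercube n)
    (μ := μ) (ν := ν) hμpC hμmC
  -- The product measure is a plan.
  have hne : {π : ProbabilityMeasure (UrbanPlanning.E n × UrbanPlanning.E n) |
      π.map measurable_fst.aemeasurable = μ ∧ π.map measurable_snd.aemeasurable = ν}.Nonempty :=
    ⟨μ.prod ν, ProbabilityMeasure.map_fst_prod μ ν, ProbabilityMeasure.map_snd_prod μ ν⟩
  obtain ⟨π, ⟨h1, h2⟩, hπ⟩ := LowerSemicontinuousOn.exists_isMinOn hne hc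
    ((UrbanPlanning.lowerSemicontinuous_lintegral hlsc).lowerSemicontinuousOn _)
  have hmem : (π : Measure (UrbanPlanning.E n × UrbanPlanning.E n)) ∈
      UrbanPlanning.transportPlans μp μm :=
    ⟨inferInstance, congrArg Subtype.val h1, congrArg Subtype.val h2⟩
  refine ⟨π, hmem, le_antisymm (iInf₂_le _ hmem) (le_iInf₂ fun ρ hρ => ?_)⟩
  obtain ⟨hρP, hρ1, hρ2⟩ := hρ
  exact hπ (a := (⟨ρ, hρP⟩ : ProbabilityMeasure _)) ⟨Subtype.ext hρ1, Subtype.ext hρ2⟩
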